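/- Let $\Omega=\bigcup_{i=1}^n(\alpha_i,\beta_i)$ with $-\infty<\alpha_1<\beta_1<\alpha_2<\beta_2<\dots<\alpha_n<\beta_n<\infty$, and let $e_\lambda(x)=e^{2\pi i\lambda x}$. A Lebesgue measurable set $S\subseteq\mathbb R$ of finite measure is called spectral with spectrum $\Lambda\subseteq\mathbb R$ if $\{e_\lambda:\lambda\in\Lambda\}$ is an orthogonal basis of $L^2(S)$. Suppose that $\Omega$ is spectral with spectrum $\Lambda$, and let $B=(b_{i,j})$ be the boundary matrix associated to $\Lambda$, that is, the unitary $n\times n$ matrix such that every $e_\lambda$, $\lambda\in\Lambda$, belongs to the domain of the operator $D_B=\frac1{2\pi i}\frac{d}{dx}$ on $L^2(\Omega)$ with boundary condition $Bf(\vec\alpha)=f(\vec\beta)$. This domain consists of the $f\in L^2(\Omega)$ that are locally absolutely continuous on each $(\alpha_i,\beta_i)$, with $f'\in L^2(\Omega)$, and that satisfy the boundary condition, where $f(\vec\alpha)=(f(\alpha_1+),\dots,f(\alpha_n+))^T$ and $f(\vec\beta)=(f(\beta_1-),\dots,f(\beta_n-))^T$; thus the requirement on $B$ is that $Be_\lambda(\vec\alpha)=e_\lambda(\vec\beta)$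 for all $\lambda\in\Lambda$. Suppose that $b_{i,j}=e^{2\pi i\theta_0}$ for some $i,j\in\{1,\dots,n\}$ and $\theta_0\in\mathbb R$. Then: (i) $\Lambda\subseteq\frac{1}{\alpha_j-\beta_i}(\mathbb Z-\theta_0)$. (ii) The sets $\Omega+k(\alpha_j-\beta_i)$, $k\in\mathbb Z$, are pairwise disjoint. (iii) If $E\subseteq\Omega$ is Lebesgue measurable with positive measure and $k\in\mathbb Z$, then the set $\tilde\Omega=(\Omega\setminus E)\cup\bigl(E+k(\alpha_j-\beta_i)\bigr)$ is spectral, and $\Lambda$ is a spectrum of $\tilde\Omega$. -/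

import Mathlib

open MeasureTheory Set Filter Topology

noncomputable section

namespace SpectralIntervals

/-- The exponential function `e_μ(x) = e^{2πiμx}`. -/
def expo (μ : ℝ) (x : ℝ) : ℂ :=
  Complex.exp (2 * Real.pi * Complex.I * μ * x)

/-- On a set of finite measure the exponentials are square integrable. -/
theorem memLp_expo {Ω : Set ℝ} (hΩ : volume Ω ≠ ⊤) (μ : ℝ) :
    MemLp (expo μ) 2 (volume.restrict Ω) := by
  have : IsFiniteMeasure (volume.restrict Ω) :=
    ⟨by rw [Measure.restrict_apply_univ]; exact lt_top_iff_ne_top.2 hΩ⟩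
  refine MemLp.of_bound (C := 1) ?_ ?_
  · unfold expo
    fun_prop
  · refine Eventually.of_forall fun x => ?_
    have h : (2 * Real.pi * Complex.I * μ * x : ℂ)
        = ((2 * Real.pi * μ * x : ℝ) : ℂ) * Complex.I := by push_cast; ring
    unfold expo
    rw [h, Complex.norm_exp_ofReal_mul_I]

/-- The exponential `e_μ` as an element of `L²(Ω)`. -/
def expoL2 {Ω : Set ℝ} (hΩ : volume Ω ≠ ⊤) (μ : ℝ) : Lp ℂ 2 (volume.restrict Ω) :=
  (memLp_expo hΩ μ).toLp (expo μ)

/-- `Λ` is a spectrum for the (Lebesgue measurable) set `Ω`, which is then called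
spectral: the set `Ω` has finite measure and the exponentials `e_μ`, `μ ∈ Λ`, form an orthogonal
basis of the Hilbert space `L²(Ω)`. -/
structure IsSpectrum (Ω Λ : Set ℝ) : Prop where
  measurable : NullMeasurableSet Ω volume
  finite : volume Ω ≠ ⊤
  ne_zero : ∀ μ ∈ Λ, expoL2 finite μ ≠ 0
  orthogonal : ∀ μ ∈ Λ, ∀ ν ∈ Λ, μ ≠ ν → inner ℂ (expoL2 finite μ) (expoL2 finite ν) = 0
  complete : (Submodule.span ℂ (expoL2 finite '' Λ)).topologicalClosure = ⊤

/-- The union of the open intervals `(α_i, β_i)`. -/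
def intervalUnion {n : ℕ} (α β : Fin n → ℝ) : Set ℝ := ⋃ i, Ioo (α i) (β i)

/-- The maximal domain of `D = (1/2πi) d/dx` on the union of the intervals `(α_i, β_i)`:
square integrable functions that are (locally) absolutely continuous on each interval, with
square integrable derivative `g`. -/
structure MemMaxDomain {n : ℕ} (α β : Fin n → ℝ) (f : ℝ → ℂ) : Prop where
  memLp : MemLp f 2 (volume.restrict (intervalUnion α β))
  exists_deriv : ∃ g : ℝ → ℂ, MemLp g 2 (volume.restrict (intervalUnion α β)) ∧
    ∀ i, ∀ x ∈ Ioo (α i) (β i), ∀ y ∈ Ioo (α i) (β i), f y - f x = ∫ t in x..y, g t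

/-- The domain of the extension `D_B`: the functions `f` of the maximal domain whose vectors of
side limits `a = (f(α_i+))_i` and `b = (f(β_i-))_i` satisfy the boundary condition `B a = b`. -/
structure MemDomain {n : ℕ} (α β : Fin n → ℝ) (B : Matrix (Fin n) (Fin n) ℂ) (f : ℝ → ℂ) :
    Prop where
  memMaxDomain : MemMaxDomain α β f
  boundary : ∃ a b : Fin n → ℂ,
    (∀ i, Tendsto f (𝓝[>] (α i)) (𝓝 (a i))) ∧ (∀ i, Tendsto f (𝓝[<] (β i)) (𝓝 (b i))) ∧
    B.mulVec a = b

/-- `B` is the boundary matrix associated to the spectrum `Λ` of the union of intervals: the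
unitary matrix for which the domain of `D_B` contains all `e_μ`, `μ ∈ Λ` (these are then
eigenfunctions of `D_B`, as `D e_μ = μ e_μ`). -/
structure IsBoundaryMatrix {n : ℕ} (α β : Fin n → ℝ) (Λ : Set ℝ)
    (B : Matrix (Fin n) (Fin n) ℂ) : Prop where
  unitary : B ∈ Matrix.unitaryGroup (Fin n) ℂ
  mem_domain : ∀ μ ∈ Λ, MemDomain α β B (expo μ)

/-- The translate `A + t` of a set `A` of real numbers. -/
def translate (A : Set ℝ) (t : ℝ) : Set ℝ := (fun x => x + t) '' A

end SpectralIntervals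

end

namespace SpectralIntervals

/-! Rows of a unitary matrix are unit vectors, so a unimodular entry in place `(i, j)` is alone in
its row, and the boundary condition in row `i` becomes `B i j * expo μ (α j) = expo μ (β i)`. Hence
`expo μ (α j - β i)` is the same constant for all `μ ∈ Λ`, which is (i); the same holds for every
shift `t = k * (α j - β i)`. If `Ω` met `Ω + t` with `t ≠ 0`, a combination of indicators of two
small balls differing by `t` would be orthogonal to the whole spectrum, against completeness
(`IsSpectrum.add_notMem`). Moving `E` by `t` multiplies every exponential on `E` by one unimodular
constant. By the disjointness this is a unitary change of variables, so orthogonality and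
completeness survive (`IsSpectrum.of_measurePreserving`). -/

theorem expo_eq (μ x : ℝ) : expo μ x = Complex.exp ((2 * Real.pi * μ * x : ℝ) * Complex.I) := by
  unfold expo
  push_cast
  ring_nf

theorem norm_expo (μ x : ℝ) : ‖expo μ x‖ = 1 := by
  rw [expo_eq, Complex.norm_exp_ofReal_mul_I]

theorem continuous_expo (μ : ℝ) : Continuous (expo μ) := by
  unfold expo
  fun_prop

theorem expo_add (μ x y : ℝ) : expo μ (x + y) = expo μ x * expo μ y := by
  unfold expo
  rw [← Complex.exp_add]
  push_cast
  ring_nf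

/-! ### Spectra expressed through integrals. -/

theorem inner_expoL2 {S : Set ℝ} (hS : volume S ≠ ⊤) (μ : ℝ)
    (f : Lp ℂ 2 (volume.restrict S)) :
    inner ℂ (expoL2 hS μ) f = ∫ x in S, (starRingEnd ℂ) (expo μ x) * f x := by
  rw [MeasureTheory.L2.inner_def]
  refine integral_congr_ae ?_
  filter_upwards [(memLp_expo hS μ).coeFn_toLp] with x hx
  rw [expoL2, hx, RCLike.inner_apply, mul_comm]

theorem expoL2_eq_zero_iff {S : Set ℝ} (hS : volume S ≠ ⊤) (μ : ℝ) :
    expoL2 hS μ = 0 ↔ volume S = 0 := by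
  rw [expoL2, Lp.eq_zero_iff_ae_eq_zero, (memLp_expo hS μ).coeFn_toLp.congr_left]
  constructor
  · intro h
    by_contra h0
    have : (ae (volume.restrict S)).NeBot := by
      rw [ae_neBot, Ne, Measure.restrict_eq_zero]
      exact h0
    obtain ⟨x, hx⟩ := h.exists
    have := norm_expo μ x
    rw [hx] at this
    simp at this
  · intro h
    rw [Measure.restrict_eq_zero.2 h, ae_zero]
    exact eventually_bot

/-- A set of frequencies is a spectrum exactly when the exponentials are orthogonal and
no nonzero square integrable function is orthogonal to all of them. -/
theorem isSpectrum_iff {S Λ : Set ℝ} :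
    IsSpectrum S Λ ↔ NullMeasurableSet S volume ∧ volume S ≠ ⊤ ∧
      (Λ.Nonempty → volume S ≠ 0) ∧
      (∀ μ ∈ Λ, ∀ ν ∈ Λ, μ ≠ ν → ∫ x in S, (starRingEnd ℂ) (expo μ x) * expo ν x = 0) ∧
      ∀ f : ℝ → ℂ, MemLp f 2 (volume.restrict S) →
        (∀ μ ∈ Λ, ∫ x in S, (starRingEnd ℂ) (expo μ x) * f x = 0) →
        f =ᵐ[volume.restrict S] 0 := by
  have key : ∀ (hS : volume S ≠ ⊤) (μ : ℝ) {f : ℝ → ℂ} (hf : MemLp f 2 (volume.restrict S)),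
      inner ℂ (expoL2 hS μ) (hf.toLp f) = ∫ x in S, (starRingEnd ℂ) (expo μ x) * f x := by
    intro hS μ f hf
    rw [inner_expoL2]
    refine integral_congr_ae ?_
    filter_upwards [hf.coeFn_toLp] with x hx
    rw [hx]
  constructor
  · rintro ⟨hm, hS, h0, ho, hc⟩
    refine ⟨hm, hS, ?_, ?_, ?_⟩
    · rintro ⟨μ, hμ⟩ h
      exact h0 μ hμ ((expoL2_eq_zero_iff hS μ).2 h)
    · intro μ hμ ν hν hne
      rw [← key hS μ (memLp_expo hS ν)]
      exact ho μ hμ ν hν hne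
    · intro f hf h
      rw [Submodule.topologicalClosure_eq_top_iff] at hc
      have hmem : hf.toLp f ∈ (Submodule.span ℂ (expoL2 hS '' Λ))ᗮ := by
        rw [Submodule.mem_orthogonal]
        intro u hu
        induction hu using Submodule.span_induction with
        | mem u hu =>
          obtain ⟨μ, hμ, rfl⟩ := hu
          rw [key hS μ hf, h μ hμ]
        | zero => simp
        | add u v _ _ hu hv => rw [inner_add_left, hu, hv, add_zero]
        | smul a u _ hu => rw [inner_smul_left, hu, mul_zero]
      rw [hc, Submodule.mem_bot] at hmem
      exact hf.coeFn_toLp.symm.trans ((Lp.eq_zero_iff_ae_eq_zero).1 hmem)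
  · rintro ⟨hm, hS, h0, ho, hc⟩
    refine ⟨hm, hS, ?_, ?_, ?_⟩
    · intro μ hμ h
      exact h0 ⟨μ, hμ⟩ ((expoL2_eq_zero_iff hS μ).1 h)
    · intro μ hμ ν hν hne
      exact (key hS μ (memLp_expo hS ν)).trans (ho μ hμ ν hν hne)
    · rw [Submodule.topologicalClosure_eq_top_iff, eq_bot_iff]
      intro f hf
      rw [Submodule.mem_orthogonal] at hf
      rw [Submodule.mem_bot, Lp.eq_zero_iff_ae_eq_zero]
      refine hc f (Lp.memLp f) fun μ hμ => ?_
      rw [← inner_expoL2 hS]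
      exact hf _ (Submodule.subset_span ⟨μ, hμ, rfl⟩)

theorem IsSpectrum.congr {S T Λ : Set ℝ} (h : IsSpectrum S Λ) (hST : S =ᵐ[volume] T) :
    IsSpectrum T Λ := by
  rw [isSpectrum_iff] at h ⊢
  rw [← Measure.restrict_congr_set hST, ← measure_congr hST]
  exact ⟨h.1.congr hST, h.2⟩

/-! ### Transport of spectra by measure preserving maps. -/

/-- A measure preserving map that multiplies the exponentials by a common unimodular function
carries a spectrum of its source to a spectrum of its target. -/
theorem IsSpectrum.of_measurePreserving {S T Λ : Set ℝ} (h : IsSpectrum S Λ)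
    (hT : NullMeasurableSet T volume) {φ : ℝ → ℝ}
    (hφ : MeasurePreserving φ (volume.restrict S) (volume.restrict T))
    {M : ℝ → ℂ} (hM : Measurable M) (hM1 : ∀ x, ‖M x‖ = 1)
    (he : ∀ μ ∈ Λ, ∀ x, expo μ (φ x) = M x * expo μ x) : IsSpectrum T Λ := by
  rw [isSpectrum_iff] at h ⊢
  obtain ⟨-, hS, h0, ho, hc⟩ := h
  have hvol : volume T = volume S := by
    have := hφ.measure_preimage (s := univ) MeasurableSet.univ.nullMeasurableSet
    simpa using this.symm
  have hMM : ∀ x, (starRingEnd ℂ) (M x) * M x = 1 := by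
    intro x
    rw [← Complex.normSq_eq_conj_mul_self, Complex.normSq_eq_norm_sq, hM1]
    simp
  have hint : ∀ (μ : ℝ) {f : ℝ → ℂ}, AEStronglyMeasurable f (volume.restrict T) →
      ∫ x in T, (starRingEnd ℂ) (expo μ x) * f x =
        ∫ x in S, (starRingEnd ℂ) (expo μ (φ x)) * f (φ x) := by
    intro μ f hf
    have hf' : AEStronglyMeasurable (fun x => (starRingEnd ℂ) (expo μ x) * f x)
        (volume.restrict T) :=
      (Complex.continuous_conj.comp (continuous_expo μ)).aestronglyMeasurable.mul hf
    rw [← hφ.map_eq] at hf' ⊢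
    exact integral_map hφ.aemeasurable hf'
  refine ⟨hT, hvol ▸ hS, fun hΛ => hvol ▸ h0 hΛ, ?_, ?_⟩
  · intro μ hμ ν hν hne
    rw [hint μ (continuous_expo ν).aestronglyMeasurable, ← ho μ hμ ν hν hne]
    refine integral_congr_ae (Eventually.of_forall fun x => ?_)
    simp only [he μ hμ, he ν hν, map_mul]
    linear_combination (starRingEnd ℂ) (expo μ x) * expo ν x * hMM x
  · intro f hf hfo
    -- Conjugating `M` cancels the twist: this function has the same integrals against the
    -- exponentials on `S` as `f` has on `T`.
    have hg : MemLp (fun x => (starRingEnd ℂ) (M x) * f (φ x)) 2 (volume.restrict S) := by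
      refine (hf.comp_measurePreserving hφ).of_le ?_ (Eventually.of_forall fun x => ?_)
      · exact (Complex.continuous_conj.measurable.comp hM).aestronglyMeasurable.mul
          (hf.comp_measurePreserving hφ).aestronglyMeasurable
      · simp [hM1]
    have hz := hc _ hg fun μ hμ => by
      rw [← hfo μ hμ, hint μ hf.aestronglyMeasurable]
      refine integral_congr_ae (Eventually.of_forall fun x => ?_)
      simp only [he μ hμ, map_mul]
      ring
    have hz' : f ∘ φ =ᵐ[volume.restrict S] 0 := by
      filter_upwards [hz] with x hx
      have hne : (starRingEnd ℂ) (M x) ≠ 0 := left_ne_zero_of_mul_eq_one (hMM x)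
      exact (mul_eq_zero.1 hx).resolve_left hne
    -- Equality of norms gives `f = 0` without an inverse of `φ`.
    have hn := eLpNorm_comp_measurePreserving (p := 2) hf.aestronglyMeasurable hφ
    rw [eLpNorm_congr_ae hz', eLpNorm_zero] at hn
    exact (eLpNorm_eq_zero_iff hf.aestronglyMeasurable two_ne_zero).1 hn.symm

/-! ### Common quasi-periods and translates. -/

/-- If all exponentials of a spectrum of an open set are quasi-periodic with the same period
and multiplier, then the set does not meet its translate by the period. -/
theorem IsSpectrum.add_notMem {S Λ : Set ℝ} (h : IsSpectrum S Λ) (hS : IsOpen S)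
    {t : ℝ} (ht : t ≠ 0) {c : ℂ} (he : ∀ μ ∈ Λ, expo μ t = c) {x : ℝ} (hx : x ∈ S) :
    x + t ∉ S := by
  intro hxt
  obtain ⟨-, hfin, -, -, hc⟩ := isSpectrum_iff.1 h
  obtain ⟨r₁, hr₁, h₁⟩ := Metric.isOpen_iff.1 hS x hx
  obtain ⟨r₂, hr₂, h₂⟩ := Metric.isOpen_iff.1 hS _ hxt
  -- The bound `|t| / 2` keeps the balls around `x` and `x + t` disjoint.
  obtain ⟨r, hr, hr1, hr2, hr3⟩ : ∃ r > 0, r ≤ r₁ ∧ r ≤ r₂ ∧ r ≤ |t| / 2 :=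
    ⟨min r₁ (min r₂ (|t| / 2)), by positivity, by simp, by simp, by simp⟩
  have : IsFiniteMeasure (volume.restrict S) :=
    ⟨by rw [Measure.restrict_apply_univ]; exact lt_top_iff_ne_top.2 hfin⟩
  set J := Metric.ball x r with hJ
  set K := Metric.ball (x + t) r with hK
  have hJS : J ⊆ S := (Metric.ball_subset_ball hr1).trans h₁
  have hKS : K ⊆ S := (Metric.ball_subset_ball hr2).trans h₂
  have hdis : Disjoint J K := by
    refine Metric.ball_disjoint_ball ?_
    rw [Real.dist_eq, sub_add_cancel_left, abs_neg]
    linarith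
  have hJm : MeasurableSet J := measurableSet_ball
  have hKm : MeasurableSet K := measurableSet_ball
  -- As `K = J + t`, the integral of a conjugated exponential over `K` is `conj c` times that over
  -- `J`, so the two terms cancel. Yet the function is `-1` on `K`.
  have hz := hc (fun y => (starRingEnd ℂ) c * J.indicator 1 y - K.indicator 1 y)
    (((memLp_indicator_const 2 hJm (1 : ℂ) (Or.inr (measure_ne_top _ _))).const_mul _).sub
      (memLp_indicator_const 2 hKm (1 : ℂ) (Or.inr (measure_ne_top _ _)))) ?_
  · have : (ae (volume.restrict K)).NeBot := by
      rw [ae_neBot, Ne, Measure.restrict_eq_zero]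
      exact (Metric.measure_ball_pos _ _ hr).ne'
    obtain ⟨y, hy, hyK⟩ :=
      ((ae_restrict_of_ae_restrict_of_subset hKS hz).and (ae_restrict_mem hKm)).exists
    simp [hyK, disjoint_right.1 hdis hyK] at hy
  · intro μ hμ
    have hi : ∀ A : Set ℝ, MeasurableSet A → A ⊆ S →
        IntegrableOn (fun y => A.indicator (fun y => (starRingEnd ℂ) (expo μ y)) y) S ∧
        ∫ y in S, A.indicator (fun y => (starRingEnd ℂ) (expo μ y)) y =
          ∫ y in A, (starRingEnd ℂ) (expo μ y) := by
      intro A hA hAS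
      refine ⟨Integrable.indicator ?_ hA, by
        rw [setIntegral_indicator hA, inter_eq_right.2 hAS]⟩
      exact Integrable.of_bound
        (Complex.continuous_conj.comp (continuous_expo μ)).aestronglyMeasurable 1
        (Eventually.of_forall fun y => by simp [norm_expo])
    have hKJ : ∫ y in K, (starRingEnd ℂ) (expo μ y) =
        (starRingEnd ℂ) c * ∫ y in J, (starRingEnd ℂ) (expo μ y) := by
      have hpre : (· + t) ⁻¹' K = J := by
        ext y
        simp [hJ, hK, Real.dist_eq]
      rw [← (measurePreserving_add_right volume t).setIntegral_preimage_emb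
        (measurableEmbedding_addRight t), hpre, ← integral_const_mul]
      refine integral_congr_ae (Eventually.of_forall fun y => ?_)
      simp only [expo_add, he μ hμ, map_mul]
      ring
    calc ∫ y in S, (starRingEnd ℂ) (expo μ y) *
          ((starRingEnd ℂ) c * J.indicator 1 y - K.indicator 1 y)
        = ∫ y in S, ((starRingEnd ℂ) c * J.indicator (fun y => (starRingEnd ℂ) (expo μ y)) y
            - K.indicator (fun y => (starRingEnd ℂ) (expo μ y)) y) := by
          refine integral_congr_ae (Eventually.of_forall fun y => ?_)
          by_cases hyJ : y ∈ J <;> by_cases hyK : y ∈ K <;> simp [hyJ, hyK] <;> ring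
      _ = 0 := by
          rw [integral_sub ((hi J hJm hJS).1.const_mul _) (hi K hKm hKS).1, integral_const_mul,
            (hi J hJm hJS).2, (hi K hKm hKS).2, hKJ, sub_self]

/-- Translating a measurable part of a set off the rest of the set preserves Lebesgue measure. -/
theorem measurePreserving_piecewise_add {S E : Set ℝ} [DecidablePred (· ∈ E)]
    (hS : MeasurableSet S) (hE : MeasurableSet E) (hES : E ⊆ S) {t : ℝ}
    (hd : Disjoint (S \ E) (translate E t)) :
    MeasurePreserving (E.piecewise (· + t) id) (volume.restrict S)
      (volume.restrict ((S \ E) ∪ translate E t)) := by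
  have hφ : Measurable (E.piecewise (· + t) id) :=
    Measurable.piecewise hE (measurable_add_const t) measurable_id
  have hEt : MeasurableSet (translate E t) :=
    (measurableEmbedding_addRight t).measurableSet_image.2 hE
  refine ⟨hφ, ?_⟩
  rw [Measure.restrict_union hd hEt]
  have hsplit : volume.restrict S = volume.restrict (S \ E) + volume.restrict E := by
    rw [← Measure.restrict_union disjoint_sdiff_left hE, sdiff_union_of_subset hES]
  rw [hsplit, Measure.map_add _ _ hφ]
  congr 1
  · rw [Measure.map_congr (g := id), Measure.map_id]
    filter_upwards [ae_restrict_mem (hS.diff hE)] with x hx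
    simp [hx.2]
  · rw [Measure.map_congr (g := (· + t))]
    · exact ((measurePreserving_add_right volume t).restrict_image_emb
        (measurableEmbedding_addRight t) E).map_eq
    · filter_upwards [ae_restrict_mem hE] with x hx
      simp [hx]

/-- Exponentials quasi-periodic with period `t` keep their span and orthogonality relations when
a part of the set is moved by `t`. -/
theorem IsSpectrum.diff_union_translate {S E Λ : Set ℝ} (h : IsSpectrum S Λ)
    (hS : MeasurableSet S) (hE : NullMeasurableSet E volume) (hES : E ⊆ S) {t : ℝ} {c : ℂ}
    (hc : ‖c‖ = 1) (he : ∀ μ ∈ Λ, expo μ t = c)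
    (hd : ∀ F ⊆ S, Disjoint (S \ F) (translate F t)) :
    IsSpectrum ((S \ E) ∪ translate E t) Λ := by
  classical
  -- The piecewise shift is measurable only for a measurable piece, so `E` is replaced by a
  -- measurable subset up to a null set; this is why `hd` ranges over all subsets.
  obtain ⟨F, hFE, hF, hFae⟩ := hE.exists_measurable_subset_ae_eq
  have hFS := hFE.trans hES
  have hFt : MeasurableSet (translate F t) :=
    (measurableEmbedding_addRight t).measurableSet_image.2 hF
  have hmain : IsSpectrum ((S \ F) ∪ translate F t) Λ := by
    refine h.of_measurePreserving ((hS.diff hF).union hFt).nullMeasurableSet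
      (measurePreserving_piecewise_add hS hF hFS (hd F hFS))
      (M := F.piecewise (fun _ => c) (fun _ => 1))
      (Measurable.piecewise hF measurable_const measurable_const) (fun x => ?_) fun μ hμ x => ?_
    · by_cases hx : x ∈ F <;> simp [hx, hc]
    · by_cases hx : x ∈ F
      · simp [hx, expo_add, he μ hμ, mul_comm]
      · simp [hx]
  have htrans : translate F t =ᵐ[volume] translate E t := by
    have hpre : ∀ A : Set ℝ, translate A t = (fun x => x - t) ⁻¹' A := by
      intro A
      simp [translate, image_add_right, sub_eq_add_neg]
    rw [hpre, hpre]
    exact (measurePreserving_sub_right volume t).quasiMeasurePreserving.preimage_ae_eq hFae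
  exact hmain.congr (((ae_eq_refl S).diff hFae).union htrans)

/-! ### The boundary matrix. -/

/-- A unitary matrix with a unimodular entry has no other nonzero entry in the same row. -/
theorem mulVec_of_norm_entry_eq_one {n : ℕ} {B : Matrix (Fin n) (Fin n) ℂ}
    (hB : B ∈ Matrix.unitaryGroup (Fin n) ℂ) {i j : Fin n} (hij : ‖B i j‖ = 1)
    (v : Fin n → ℂ) : B.mulVec v i = B i j * v j := by
  have hrow : ∑ k, ‖B i k‖ ^ 2 = 1 := by
    have h := congrFun (congrFun (Matrix.mem_unitaryGroup_iff.1 hB) i) i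
    simp only [Matrix.mul_apply, Matrix.star_apply, Matrix.one_apply_eq, RCLike.star_def,
      Complex.mul_conj, Complex.normSq_eq_norm_sq] at h
    exact_mod_cast h
  rw [← Finset.add_sum_erase _ _ (Finset.mem_univ j), hij, one_pow, add_eq_left,
    Finset.sum_eq_zero_iff_of_nonneg fun _ _ => by positivity] at hrow
  rw [Matrix.mulVec, dotProduct]
  refine Finset.sum_eq_single j (fun k _ hk => ?_) (by simp)
  have := hrow k (by simp [hk])
  rw [norm_eq_zero.1 (pow_eq_zero_iff two_ne_zero |>.1 this), zero_mul]

/-- Exponentials are continuous, so their side limits are the endpoint values, and row `i` of the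
boundary condition has a single term. -/
theorem IsBoundaryMatrix.entry_mul_expo {n : ℕ} {α β : Fin n → ℝ} {Λ : Set ℝ}
    {B : Matrix (Fin n) (Fin n) ℂ} (hB : IsBoundaryMatrix α β Λ B) {i j : Fin n}
    (hij : ‖B i j‖ = 1) {μ : ℝ} (hμ : μ ∈ Λ) : B i j * expo μ (α j) = expo μ (β i) := by
  obtain ⟨a, b, ha, hb, hab⟩ := (hB.mem_domain μ hμ).boundary
  have ha' : a j = expo μ (α j) := tendsto_nhds_unique (ha j)
    ((continuous_expo μ).continuousAt.mono_left nhdsWithin_le_nhds)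
  have hb' : b i = expo μ (β i) := tendsto_nhds_unique (hb i)
    ((continuous_expo μ).continuousAt.mono_left nhdsWithin_le_nhds)
  rw [← ha', ← hb', ← hab, mulVec_of_norm_entry_eq_one hB.unitary hij]

end SpectralIntervals

theorem proposition3p5 {n : ℕ} (α β : Fin n → ℝ)
    (hαβ : ∀ i, α i < β i) (hβα : ∀ i j, i < j → β i < α j)
    (Λ : Set ℝ) (hΛ : SpectralIntervals.IsSpectrum (SpectralIntervals.intervalUnion α β) Λ)
    (B : Matrix (Fin n) (Fin n) ℂ) (hB : SpectralIntervals.IsBoundaryMatrix α β Λ B)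
    (i j : Fin n) (θ₀ : ℝ) (hij : B i j = Complex.exp (2 * Real.pi * Complex.I * θ₀)) :
    (Λ ⊆ Set.range (fun m : ℤ => 1 / (α j - β i) * ((m : ℝ) - θ₀))) ∧
    (∀ k m : ℤ, k ≠ m →
      Disjoint
        (SpectralIntervals.translate (SpectralIntervals.intervalUnion α β) (k * (α j - β i)))
        (SpectralIntervals.translate (SpectralIntervals.intervalUnion α β) (m * (α j - β i)))) ∧
    (∀ E : Set ℝ, E ⊆ SpectralIntervals.intervalUnion α β →
      MeasureTheory.NullMeasurableSet E MeasureTheory.volume → 0 < MeasureTheory.volume E →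
      ∀ k : ℤ,
        SpectralIntervals.IsSpectrum
          ((SpectralIntervals.intervalUnion α β \ E) ∪
            SpectralIntervals.translate E (k * (α j - β i))) Λ) := by
  have hnorm : ‖B i j‖ = 1 := by
    rw [hij, ← Complex.norm_exp_ofReal_mul_I (2 * Real.pi * θ₀)]
    congr 2
    push_cast
    ring
  -- A gap between intervals if `i < j`; negative otherwise.
  have hne : α j - β i ≠ 0 := by
    rcases lt_or_ge i j with h | h
    · exact (sub_pos.2 (hβα i j h)).ne'
    · rcases h.eq_or_lt with rfl | h
      · exact (sub_neg.2 (hαβ _)).ne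
      · exact (sub_neg.2 (((hαβ j).trans (hβα j i h)).trans (hαβ i))).ne
  have hfreq : ∀ μ ∈ Λ, ∃ m : ℤ, μ * (α j - β i) = m - θ₀ := by
    intro μ hμ
    have h := hB.entry_mul_expo hnorm hμ
    rw [hij, SpectralIntervals.expo, SpectralIntervals.expo, ← Complex.exp_add,
      Complex.exp_eq_exp_iff_exists_int] at h
    obtain ⟨m, hm⟩ := h
    refine ⟨m, ?_⟩
    have h2 : (2 * Real.pi * Complex.I : ℂ) ≠ 0 := Complex.two_pi_I_ne_zero
    have h3 : ((θ₀ + μ * α j : ℝ) : ℂ) = ((μ * β i + m : ℝ) : ℂ) := by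
      refine mul_left_cancel₀ h2 ?_
      push_cast
      linear_combination hm
    have h4 : θ₀ + μ * α j = μ * β i + m := Complex.ofReal_injective h3
    linarith
  -- Here `μ * k * (α j - β i) = k * m - k * θ₀`; only the integer `k * m` depends on `μ`, and it
  -- disappears in the exponential.
  have hexpo : ∀ k : ℤ, ∀ μ ∈ Λ, SpectralIntervals.expo μ (k * (α j - β i)) =
      Complex.exp ((2 * Real.pi * (-(k * θ₀)) : ℝ) * Complex.I) := by
    intro k μ hμ
    obtain ⟨m, hm⟩ := hfreq μ hμ
    rw [SpectralIntervals.expo_eq, Complex.exp_eq_exp_iff_exists_int]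
    refine ⟨k * m, ?_⟩
    rw [show 2 * Real.pi * μ * (k * (α j - β i)) = 2 * Real.pi * k * (m - θ₀) by
      rw [← hm]; ring]
    push_cast
    ring
  have hopen : IsOpen (SpectralIntervals.intervalUnion α β) :=
    isOpen_iUnion fun _ => isOpen_Ioo
  have hnot : ∀ k : ℤ, k ≠ 0 → ∀ x ∈ SpectralIntervals.intervalUnion α β,
      x + k * (α j - β i) ∉ SpectralIntervals.intervalUnion α β := fun k hk x hx =>
    hΛ.add_notMem hopen (mul_ne_zero (Int.cast_ne_zero.2 hk) hne) (hexpo k) hx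
  refine ⟨fun μ hμ => ?_, fun k m hkm => ?_, fun E hES hE _ k => ?_⟩
  · obtain ⟨m, hm⟩ := hfreq μ hμ
    refine ⟨m, ?_⟩
    simp only [← hm]
    field_simp
  · rw [Set.disjoint_left]
    rintro _ ⟨x, hx, rfl⟩ ⟨y, hy, hxy⟩
    refine hnot (k - m) (sub_ne_zero.2 hkm) x hx ?_
    convert hy using 1
    simp only at hxy
    push_cast
    linarith
  · refine hΛ.diff_union_translate hopen.measurableSet hE hES
      (Complex.norm_exp_ofReal_mul_I _) (hexpo k) fun F hFS => ?_
    rw [Set.disjoint_right]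
    rintro _ ⟨x, hx, rfl⟩ ⟨hxS, hxF⟩
    -- For `k = 0` the translate of `F` is `F` itself, which is disjoint from its complement.
    rcases eq_or_ne k 0 with rfl | hk
    · simp [hx] at hxF
    · exact hnot k hk x (hFS hx) hxS
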